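/- **Theorem (the forest formula).** Let $n$ be a natural number, let $K_n$ be the complete graph on $\{1,\dots,n\}$, and let $E_n$ be its set of edges $\ell=(i,j)$, $i<j$. Let $\mathrm{PS}_n$ be the set of positive semidefinite symmetric real $n\times n$ matrices whose diagonal entries are all equal to $1$ and whose off-diagonal entries lie in $[0,1]$. A matrix $X\in\mathrm{PS}_n$ is parametrized by its entries $X_\ell$, $\ell\in E_n$, so that $\mathrm{PS}_n$ is identified with a subset of $\mathbb R^{E_n}$; its interior is taken in $\mathbb R^{E_n}$. Let $f$ be a function on $\mathrm{PS}_n$ with values in $\mathbb R$ (or, more generally, in a real Banach space), continuous on $\mathrm{PS}_n$ and $C^\infty$ in the interior of $\mathrm{PS}_n$, such that every iterated partial derivative of $f$ in the variables $X_\ell$ extends continuously from the interior to $\mathrm{PS}_n$; the extension is denoted by the same symbol. For a forest $F$ (the edge set of an acyclic subgraph of $K_n$ on the vertex set $\{1,\dots,n\}$, the empty forest included) and $w_F=(w_\ell)_{\ell\in F}\in[0,1]^F$, let $\partial_F=\prod_{\ell\in F}\partial/\partial X_\ell$, and let $X^F(w_F)$ be the symmetric $n\times n$ matrix with $X^F_{ii}(w_F)=1$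 for all $i$ and, for $i\neq j$, with $X^F_{ij}(w_F)$ equal to the infimum of the $w_\ell$ over the edges $\ell$ of the unique path from $i$ to $j$ in $F$ if such a path exists, and to $0$ otherwise. Then $X^F(w_F)\in\mathrm{PS}_n$ for every forest $F$ and every $w_F\in[0,1]^F$ (in particular $X^F(w_F)$ is positive semidefinite), the function $w_F\mapsto \partial_F f[X^F(w_F)]$ is integrable on $[0,1]^F$, and $$ f(\mathbf 1)=\sum_{F}\int_{[0,1]^F}\Big(\prod_{\ell\in F}dw_\ell\Big)\,\partial_F f\big[X^F(w_F)\big], $$ where $\mathbf 1$ is the matrix with all entries equal to $1$, the sum runs over all forests $F$, and the term of the empty forest is $f(\mathrm{Id})$. -/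

import Mathlib

open scoped ContDiff
open MeasureTheory

noncomputable section

namespace ForestFormula

/-- The edges `ℓ = (i, j)`, `i < j`, of the complete graph `K_n` on the vertices `Fin n`. -/
abbrev Edge (n : ℕ) : Type := {p : Fin n × Fin n // p.1 < p.2}

/-- `PS_n`: the positive (semidefinite) symmetric real matrices with all diagonal entries equal
to `1` and all off-diagonal entries in `[0, 1]`. -/
def PS (n : ℕ) : Set (Matrix (Fin n) (Fin n) ℝ) :=
  {X | X.PosSemidef ∧ (∀ i, X i i = 1) ∧ ∀ i j, i ≠ j → X i j ∈ Set.Icc (0 : ℝ) 1}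

/-- The symmetric matrix with unit diagonal whose off-diagonal entries are the `x_ℓ`. -/
def edgeMatrix {n : ℕ} (x : Edge n → ℝ) : Matrix (Fin n) (Fin n) ℝ :=
  Matrix.of fun i j =>
    if h : i < j then x ⟨(i, j), h⟩ else if h : j < i then x ⟨(j, i), h⟩ else 1

/-- The coordinates `X_ℓ`, `ℓ ∈ E_n`, of a matrix. -/
def coords {n : ℕ} (X : Matrix (Fin n) (Fin n) ℝ) : Edge n → ℝ :=
  fun ℓ => X ℓ.1.1 ℓ.1.2

/-- The set `PS_n` in the coordinates `(x_ℓ)`. The interior of `PS_n` is the interior of this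
subset of `ℝ^{E_n}`. -/
def PSCoord (n : ℕ) : Set (Edge n → ℝ) := {x | edgeMatrix x ∈ PS n}

/-- First-order partial derivative `∂_ℓ` with respect to the coordinate `x_ℓ`. -/
def partialDeriv {n : ℕ} {E : Type*} [NormedAddCommGroup E] [NormedSpace ℝ E]
    (ℓ : Edge n) (g : (Edge n → ℝ) → E) (x : Edge n → ℝ) : E :=
  lineDeriv ℝ g x (Pi.single ℓ 1)

/-- The iterated partial derivative `∂_{ℓ₁} ∂_{ℓ₂} ⋯ ∂_{ℓ_k} g`. -/
def iterPartial {n : ℕ} {E : Type*} [NormedAddCommGroup E] [NormedSpace ℝ E]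
    (L : List (Edge n)) (g : (Edge n → ℝ) → E) : (Edge n → ℝ) → E :=
  L.foldr partialDeriv g

/-- `f` is smooth in the interior of `PS_n`, it is continuous on `PS_n`, and each of its iterated
partial derivatives has a continuous extension from the interior to `PS_n`. -/
structure SmoothOnPS {n : ℕ} {E : Type*} [NormedAddCommGroup E] [NormedSpace ℝ E]
    (f : Matrix (Fin n) (Fin n) ℝ → E) : Prop where
  contDiffOn_interior : ContDiffOn ℝ ∞ (fun x => f (edgeMatrix x)) (interior (PSCoord n))
  continuousOn : ContinuousOn (fun x => f (edgeMatrix x)) (PSCoord n)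
  exists_extension : ∀ L : List (Edge n), ∃ g : (Edge n → ℝ) → E,
    ContinuousOn g (PSCoord n) ∧
      Set.EqOn g (iterPartial L fun x => f (edgeMatrix x)) (interior (PSCoord n))

/-- The graph on `n` vertices with edge set `F`. -/
def graph {n : ℕ} (F : Finset (Edge n)) : SimpleGraph (Fin n) :=
  SimpleGraph.fromEdgeSet {e | ∃ ℓ ∈ F, e = s(ℓ.1.1, ℓ.1.2)}

open Classical in
/-- The forests over `n` labelled vertices, including the empty one, as sets of edges. -/
def forests (n : ℕ) : Finset (Finset (Edge n)) :=
  Finset.univ.filter fun F => (graph F).IsAcyclic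

/-- `∂_F f [X] = (∏_{ℓ ∈ F} ∂_ℓ) f [X]` for `X ∈ PS_n`: the iterated partial derivative in the
interior of `PS_n`, extended by continuity to `PS_n`. As `f` is smooth in the interior, the order
in which the edges of `F` are listed is irrelevant. -/
def forestDeriv {n : ℕ} {E : Type*} [NormedAddCommGroup E] [NormedSpace ℝ E]
    (F : Finset (Edge n)) (f : Matrix (Fin n) (Fin n) ℝ → E)
    (X : Matrix (Fin n) (Fin n) ℝ) : E :=
  extendFrom (interior (PSCoord n)) (iterPartial F.toList fun x => f (edgeMatrix x)) (coords X)

open Classical in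
/-- The matrix `X^F(w)`: `1` on the diagonal, and for `i ≠ j` the infimum of the `w_ℓ` over the
edges `ℓ` of the path from `i` to `j` in `F` (unique when `F` is a forest), or `0` if there is no
such path. -/
def forestMatrix {n : ℕ} (F : Finset (Edge n)) (w : F → ℝ) : Matrix (Fin n) (Fin n) ℝ :=
  Matrix.of fun i j =>
    if i = j then 1
    else if (graph F).Reachable i j then
      sInf {r : ℝ | ∃ p : (graph F).Walk i j, p.IsPath ∧
        ∃ ℓ : F, s(ℓ.1.1.1, ℓ.1.1.2) ∈ p.edges ∧ r = w ℓ}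
    else 0

end ForestFormula

end

open ForestFormula

open scoped ContDiff
open MeasureTheory

noncomputable section

namespace ForestFormula

variable {n : ℕ}

/-! ### Ultrametric matrices are positive semidefinite -/

/-! The proof telescopes over forests. For a forest `F` with weights `w`, let `interp F s w` be the
point of `PS_n` obtained by raising to `s` all entries of `X^F(w)` below `s`, and let `m` be the
least weight (`1` if `F` is empty). For `s ≤ m` only the zero entries between different components
move, and they equal `s`. The fundamental theorem of calculus on `[0, m]` therefore writes `∂_F
f[X^F(w)]` as the value of `∂_F f` at `interp F m w` minus, for each edge `ℓ` joining two
components, the integral over `s ≤ m` of `∂_{F ∪ ℓ} f` at `interp F s w`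
(`SmoothOnPS.extDeriv_interp_sub`).

By `interp_insert`, that point is also `interp (F ∪ ℓ) s` when `ℓ` gets weight `s`. After
integration over `w`, the subtracted term is thus the part of the leading term of `F ∪ ℓ` on the
event that `ℓ` has the least weight. Almost surely a nonempty forest has exactly one least edge, so
its leading term is the sum of these parts over its edges. Everything cancels except the leading
term of the empty forest, which is `f(𝟏)`.

Two facts support this. The points stay in `PS_n` because their entries are ultrametric: every
superlevel set is an equivalence relation, and integrating over levels gives positivity
(`posSemidef_of_ultrametric`). The path may lie on the boundary of `PS_n`; convexity allows it to be
pushed into the interior and recovered in the limit (`sub_eq_integral_of_convex`). -/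

lemma sum_mul_equivalence_nonneg {ι : Type*} [Fintype ι] (r : Setoid ι) [DecidableRel r.r]
    (v : ι → ℝ) : 0 ≤ ∑ i, ∑ j, v i * v j * (if r.r i j then 1 else 0) := by
  classical
  -- The form is the sum over classes of the squared class sum of `v`. Classes are indexed by their
  -- representatives `c : ι`; any other `c` contributes `0`.
  have h : ∑ i, ∑ j, v i * v j * (if r.r i j then (1 : ℝ) else 0)
      = ∑ c, (∑ i, if (Quotient.mk r i).out = c then v i else 0) ^ 2 := by
    simp_rw [sq, Finset.sum_mul_sum]
    symm
    rw [Finset.sum_comm]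
    refine Finset.sum_congr rfl fun i _ => ?_
    rw [Finset.sum_comm]
    refine Finset.sum_congr rfl fun j _ => ?_
    have : r.r i j ↔ (Quotient.mk r j).out = (Quotient.mk r i).out := by
      rw [Quotient.out_inj]
      exact ⟨fun h => Quotient.sound (r.symm h), fun h => r.symm (Quotient.exact h)⟩
    rw [Finset.sum_eq_single (Quotient.mk r i).out]
    · by_cases h : r.r i j
      · rw [if_pos rfl, if_pos (this.1 h), if_pos h, mul_one]
      · rw [if_neg (mt this.2 h), if_neg h, mul_zero, mul_zero]
    · intro c _ hc
      rw [if_neg (Ne.symm hc), zero_mul]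
    · simp
  rw [h]
  positivity

lemma integral_indicator_le {x : ℝ} (hx : x ∈ Set.Icc (0 : ℝ) 1) :
    ∫ t in Set.Ioc (0 : ℝ) 1, (if t ≤ x then (1 : ℝ) else 0) = x := by
  have h : (fun t : ℝ => if t ≤ x then (1 : ℝ) else 0) = (Set.Iic x).indicator fun _ => 1 := by
    ext t; simp [Set.indicator]
  rw [h, setIntegral_indicator measurableSet_Iic]
  have : Set.Ioc (0 : ℝ) 1 ∩ Set.Iic x = Set.Ioc 0 x := by
    ext t; simp only [Set.mem_inter_iff, Set.mem_Ioc, Set.mem_Iic]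
    exact ⟨fun h => ⟨h.1.1, h.2⟩, fun h => ⟨⟨h.1, h.2.trans hx.2⟩, h.2⟩⟩
  simp [this, hx.1]

lemma integrable_indicator_le (x : ℝ) :
    Integrable (fun t : ℝ => if t ≤ x then (1 : ℝ) else 0)
      (volume.restrict (Set.Ioc (0 : ℝ) 1)) := by
  have h : (fun t : ℝ => if t ≤ x then (1 : ℝ) else 0) = (Set.Iic x).indicator fun _ => 1 := by
    ext t; simp [Set.indicator]
  rw [h]
  exact (integrable_const 1).indicator measurableSet_Iic

/-- A symmetric matrix with unit diagonal and entries in `[0, 1]` which satisfies the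
ultrametric inequality is positive semidefinite. -/
lemma posSemidef_of_ultrametric (X : Matrix (Fin n) (Fin n) ℝ) (hd : ∀ i, X i i = 1)
    (hs : ∀ i j, X i j = X j i) (h01 : ∀ i j, X i j ∈ Set.Icc (0 : ℝ) 1)
    (hu : ∀ i j k, min (X i j) (X j k) ≤ X i k) : X.PosSemidef := by
  classical
  refine Matrix.PosSemidef.of_dotProduct_mulVec_nonneg ?_ fun v => ?_
  · ext i j; simp [Matrix.conjTranspose_apply, hs i j]
  -- Layer-cake decomposition: each entry is the integral over `t` in `(0, 1]` of the indicator of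
  -- `t ≤ X i j`.
  have h : star v ⬝ᵥ X.mulVec v = ∫ t in Set.Ioc (0 : ℝ) 1,
      ∑ i, ∑ j, v i * v j * (if t ≤ X i j then 1 else 0) := by
    rw [integral_finsetSum]
    swap
    · exact fun i _ => integrable_finsetSum _ fun j _ => (integrable_indicator_le _).const_mul _
    simp only [dotProduct, Matrix.mulVec, star_trivial, Finset.mul_sum]
    refine Finset.sum_congr rfl fun i _ => ?_
    rw [integral_finsetSum]
    swap
    · exact fun j _ => (integrable_indicator_le _).const_mul _
    refine Finset.sum_congr rfl fun j _ => ?_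
    rw [integral_const_mul, integral_indicator_le (h01 i j)]
    ring
  rw [h]
  refine setIntegral_nonneg measurableSet_Ioc fun t ht => ?_
  -- The ultrametric inequality is exactly transitivity of `t ≤ X i j`.
  let r : Setoid (Fin n) := ⟨fun i j => t ≤ X i j, fun i => by simpa [hd] using ht.2,
    fun {i j} h => by rwa [hs], fun {i j k} h h' => (le_min h h').trans (hu i j k)⟩
  exact sum_mul_equivalence_nonneg r v

/-! ### The graph of a set of edges -/

/-- The edge as an unordered pair. -/
def Edge.toSym2 (ℓ : Edge n) : Sym2 (Fin n) := s(ℓ.1.1, ℓ.1.2)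

lemma Edge.toSym2_injective : Function.Injective (Edge.toSym2 (n := n)) := by
  rintro ⟨⟨a, b⟩, h⟩ ⟨⟨c, d⟩, h'⟩ e
  simp only [Edge.toSym2, Sym2.eq_iff] at e
  rcases e with ⟨rfl, rfl⟩ | ⟨rfl, rfl⟩
  · rfl
  · exact absurd h (not_lt.2 (le_of_lt h'))

lemma mem_edgeSet_graph {F : Finset (Edge n)} {e : Sym2 (Fin n)} :
    e ∈ (graph F).edgeSet ↔ ∃ ℓ ∈ F, e = ℓ.toSym2 := by
  simp only [graph, SimpleGraph.edgeSet_fromEdgeSet, Set.mem_sdiff, Set.mem_ofPred_eq, Edge.toSym2]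
  refine ⟨fun h => h.1, fun h => ⟨h, ?_⟩⟩
  obtain ⟨ℓ, -, rfl⟩ := h
  simpa using ℓ.2.ne

lemma toSym2_mem_edgeSet_graph {F : Finset (Edge n)} {ℓ : Edge n} :
    ℓ.toSym2 ∈ (graph F).edgeSet ↔ ℓ ∈ F := by
  rw [mem_edgeSet_graph]
  exact ⟨fun ⟨ℓ', h, e⟩ => Edge.toSym2_injective e ▸ h, fun h => ⟨ℓ, h, rfl⟩⟩

lemma graph_mono {F F' : Finset (Edge n)} (h : F ⊆ F') : graph F ≤ graph F' := by
  rw [← SimpleGraph.edgeSet_subset_edgeSet]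
  intro e he
  obtain ⟨ℓ, hℓ, rfl⟩ := mem_edgeSet_graph.1 he
  exact mem_edgeSet_graph.2 ⟨ℓ, h hℓ, rfl⟩

lemma mem_forests {F : Finset (Edge n)} : F ∈ forests n ↔ (graph F).IsAcyclic := by
  simp [forests]

lemma mem_forests_of_subset {F F' : Finset (Edge n)} (h : F ⊆ F') (h' : F' ∈ forests n) :
    F ∈ forests n :=
  mem_forests.2 ((mem_forests.1 h').anti (graph_mono h))

lemma graph_empty : graph (∅ : Finset (Edge n)) = ⊥ := by
  simp [graph]

lemma graph_insert (F : Finset (Edge n)) (ℓ : Edge n) :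
    graph (insert ℓ F) = graph F ⊔ SimpleGraph.edge ℓ.1.1 ℓ.1.2 := by
  rw [graph, graph, SimpleGraph.edge, ← SimpleGraph.fromEdgeSet_union]
  congr 1
  ext e
  simp

open Classical in
/-- The edges joining different connected components of `F`. -/
def bridging (F : Finset (Edge n)) : Finset (Edge n) :=
  Finset.univ.filter fun ℓ => ¬ (graph F).Reachable ℓ.1.1 ℓ.1.2

/-- A new edge closes a cycle exactly when its endpoints are already connected. An edge of `F`
itself connects its endpoints, so it is never bridging. -/
lemma mem_bridging_iff {F : Finset (Edge n)} (hF : F ∈ forests n)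
    {ℓ : Edge n} : ℓ ∈ bridging F ↔ ℓ ∉ F ∧ insert ℓ F ∈ forests n := by
  have h2 : (graph F).Adj ℓ.1.1 ℓ.1.2 ↔ ℓ ∈ F := by
    rw [← SimpleGraph.mem_edgeSet]; exact toSym2_mem_edgeSet_graph
  rw [mem_forests, graph_insert, SimpleGraph.isAcyclic_sup_fromEdgeSet_iff, h2]
  simp only [bridging, Finset.mem_filter, Finset.mem_univ, true_and, ℓ.2.ne, false_or,
    mem_forests.1 hF]
  constructor
  · exact fun h => ⟨fun h' => h (h2.2 h').reachable, fun h' => absurd h' h⟩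
  · exact fun h h' => h.1 (h.2 h')

/-! ### The matrix of a weighted forest -/

open Classical in
/-- The edges of `F` on the paths from `i` to `j`. -/
def pathEdges (F : Finset (Edge n)) (i j : Fin n) : Finset (Edge n) :=
  F.filter fun ℓ => ∃ p : (graph F).Walk i j, p.IsPath ∧ ℓ.toSym2 ∈ p.edges

lemma mem_pathEdges {F : Finset (Edge n)} {i j : Fin n} {ℓ : Edge n} :
    ℓ ∈ pathEdges F i j ↔ ℓ ∈ F ∧ ∃ p : (graph F).Walk i j, p.IsPath ∧ ℓ.toSym2 ∈ p.edges := by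
  simp [pathEdges]

lemma mem_pathEdges_iff {F : Finset (Edge n)} (hF : F ∈ forests n) {i j : Fin n}
    {p : (graph F).Walk i j} (hp : p.IsPath) {ℓ : Edge n} :
    ℓ ∈ pathEdges F i j ↔ ℓ.toSym2 ∈ p.edges := by
  rw [mem_pathEdges]
  refine ⟨?_, fun h => ⟨toSym2_mem_edgeSet_graph.1 (p.edges_subset_edgeSet h), p, hp, h⟩⟩
  rintro ⟨-, q, hq, h⟩
  have := ((mem_forests.1 hF).subsingleton_path i j).elim ⟨p, hp⟩ ⟨q, hq⟩
  rw [Subtype.mk.injEq] at this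
  rwa [this]

lemma pathEdges_nonempty {F : Finset (Edge n)} {i j : Fin n} (hij : i ≠ j)
    (h : (graph F).Reachable i j) : (pathEdges F i j).Nonempty := by
  obtain ⟨p, hp⟩ := h.exists_isPath
  cases p with
  | nil => exact absurd rfl hij
  | cons ha q =>
    obtain ⟨ℓ, hℓ, e⟩ := mem_edgeSet_graph.1 ((SimpleGraph.mem_edgeSet _).2 ha)
    exact ⟨ℓ, mem_pathEdges.2 ⟨hℓ, _, hp, by simp [← e]⟩⟩

lemma pathEdges_comm (F : Finset (Edge n)) (i j : Fin n) : pathEdges F i j = pathEdges F j i := by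
  have : ∀ i j, pathEdges F i j ⊆ pathEdges F j i := fun i j ℓ h => by
    rw [mem_pathEdges] at h ⊢
    obtain ⟨h, p, hp, h'⟩ := h
    exact ⟨h, p.reverse, hp.reverse, by simpa using h'⟩
  exact (this i j).antisymm (this j i)

/-- Shortcutting the concatenation of the paths `i → j` and `j → k` gives the path `i → k` without
using new edges. This is the source of the ultrametric inequality. -/
lemma pathEdges_trans {F : Finset (Edge n)} (hF : F ∈ forests n) {i j k : Fin n}
    (hij : (graph F).Reachable i j) (hjk : (graph F).Reachable j k) {ℓ : Edge n}
    (h : ℓ ∈ pathEdges F i k) : ℓ ∈ pathEdges F i j ∨ ℓ ∈ pathEdges F j k := by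
  classical
  obtain ⟨p, hp⟩ := hij.exists_isPath
  obtain ⟨q, hq⟩ := hjk.exists_isPath
  rw [mem_pathEdges_iff hF (p.append q).bypass_isPath] at h
  have := (p.append q).edges_bypass_subset_edges h
  rw [SimpleGraph.Walk.edges_append, List.mem_append] at this
  rwa [mem_pathEdges_iff hF hp, mem_pathEdges_iff hF hq]

lemma forestMatrix_of_reachable {F : Finset (Edge n)} (w : Edge n → ℝ) {i j : Fin n} (hij : i ≠ j)
    (h : (graph F).Reachable i j) :
    forestMatrix F (fun ℓ => w ℓ) i j = (pathEdges F i j).inf' (pathEdges_nonempty hij h) w := by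
  rw [Finset.inf'_eq_csInf_image]
  simp only [forestMatrix, Matrix.of_apply, hij, h, if_true, if_false]
  congr 1
  ext r
  simp only [Set.mem_ofPred_eq, Set.mem_image, Finset.mem_coe, mem_pathEdges]
  constructor
  · rintro ⟨p, hp, ℓ, hℓ, rfl⟩
    exact ⟨ℓ, ⟨ℓ.2, p, hp, hℓ⟩, rfl⟩
  · rintro ⟨ℓ, ⟨hℓ, p, hp, h⟩, rfl⟩
    exact ⟨p, hp, ⟨ℓ, hℓ⟩, h, rfl⟩

lemma forestMatrix_of_not_reachable {F : Finset (Edge n)} (w : F → ℝ) {i j : Fin n}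
    (h : ¬ (graph F).Reachable i j) : forestMatrix F w i j = 0 := by
  have hij : i ≠ j := by rintro rfl; exact h (SimpleGraph.Reachable.refl i)
  simp [forestMatrix, hij, h]

lemma forestMatrix_self (F : Finset (Edge n)) (w : F → ℝ) (i : Fin n) :
    forestMatrix F w i i = 1 := by
  simp [forestMatrix]

lemma forestMatrix_comm (F : Finset (Edge n)) (w : Edge n → ℝ) (i j : Fin n) :
    forestMatrix F (fun ℓ => w ℓ) i j = forestMatrix F (fun ℓ => w ℓ) j i := by
  by_cases hij : i = j
  · rw [hij]
  by_cases h : (graph F).Reachable i j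
  · rw [forestMatrix_of_reachable w hij h, forestMatrix_of_reachable w (Ne.symm hij) h.symm]
    simp only [pathEdges_comm F i j]
  · rw [forestMatrix_of_not_reachable _ h,
      forestMatrix_of_not_reachable _ fun h' => h h'.symm]

lemma forestMatrix_mem_Icc {F : Finset (Edge n)} {w : Edge n → ℝ}
    (hw : ∀ ℓ ∈ F, w ℓ ∈ Set.Icc (0 : ℝ) 1) (i j : Fin n) :
    forestMatrix F (fun ℓ => w ℓ) i j ∈ Set.Icc (0 : ℝ) 1 := by
  by_cases hij : i = j
  · rw [hij, forestMatrix_self]; simp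
  by_cases h : (graph F).Reachable i j
  · rw [forestMatrix_of_reachable w hij h]
    refine ⟨Finset.le_inf' _ _ fun ℓ hℓ => (hw ℓ (mem_pathEdges.1 hℓ).1).1, ?_⟩
    obtain ⟨ℓ, hℓ⟩ := pathEdges_nonempty hij h
    exact (Finset.inf'_le _ hℓ).trans (hw ℓ (mem_pathEdges.1 hℓ).1).2
  · rw [forestMatrix_of_not_reachable _ h]; simp

lemma forestMatrix_ultrametric {F : Finset (Edge n)} (hF : F ∈ forests n) {w : Edge n → ℝ}
    (hw : ∀ ℓ ∈ F, w ℓ ∈ Set.Icc (0 : ℝ) 1) (i j k : Fin n) :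
    min (forestMatrix F (fun ℓ => w ℓ) i j) (forestMatrix F (fun ℓ => w ℓ) j k)
      ≤ forestMatrix F (fun ℓ => w ℓ) i k := by
  by_cases hik : i = k
  · rw [hik, forestMatrix_self]
    exact (min_le_left _ _).trans (forestMatrix_mem_Icc hw _ _).2
  by_cases hij : i = j
  · rw [hij]; exact min_le_right _ _
  by_cases hjk : j = k
  · rw [hjk]; exact min_le_left _ _
  by_cases h1 : (graph F).Reachable i j
  swap
  · rw [forestMatrix_of_not_reachable _ h1]
    exact (min_le_left _ _).trans (forestMatrix_mem_Icc hw _ _).1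
  by_cases h2 : (graph F).Reachable j k
  swap
  · rw [forestMatrix_of_not_reachable _ h2]
    exact (min_le_right _ _).trans (forestMatrix_mem_Icc hw _ _).1
  rw [forestMatrix_of_reachable w hij h1, forestMatrix_of_reachable w hjk h2,
    forestMatrix_of_reachable w hik (h1.trans h2)]
  refine Finset.le_inf' _ _ fun ℓ hℓ => ?_
  rcases pathEdges_trans hF h1 h2 hℓ with h | h
  · exact (min_le_left _ _).trans (Finset.inf'_le _ h)
  · exact (min_le_right _ _).trans (Finset.inf'_le _ h)

lemma continuous_forestMatrix (F : Finset (Edge n)) (i j : Fin n) :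
    Continuous fun w : Edge n → ℝ => forestMatrix F (fun ℓ => w ℓ) i j := by
  by_cases hij : i = j
  · simp only [hij, forestMatrix_self]; exact continuous_const
  by_cases h : (graph F).Reachable i j
  · simp only [forestMatrix_of_reachable _ hij h]
    exact Continuous.finset_inf'_apply _ fun ℓ _ => continuous_apply ℓ
  · simp only [forestMatrix_of_not_reachable _ h]; exact continuous_const

/-- The coordinates of the matrix of the weighted forest `F`, the entries below `s` being
raised to `s`. -/
def interp (F : Finset (Edge n)) (s : ℝ) (w : Edge n → ℝ) : Edge n → ℝ :=
  fun ℓ => max s (forestMatrix F (fun e => w e) ℓ.1.1 ℓ.1.2)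

lemma continuous_interp (F : Finset (Edge n)) :
    Continuous fun q : ℝ × (Edge n → ℝ) => interp F q.1 q.2 :=
  continuous_pi fun _ => continuous_fst.max ((continuous_forestMatrix F _ _).comp continuous_snd)

lemma edgeMatrix_self (x : Edge n → ℝ) (i : Fin n) : edgeMatrix x i i = 1 := by
  simp [edgeMatrix]

lemma edgeMatrix_comm (x : Edge n → ℝ) (i j : Fin n) : edgeMatrix x i j = edgeMatrix x j i := by
  rcases lt_trichotomy i j with h | h | h
  · simp [edgeMatrix, h, h.not_gt]
  · rw [h]
  · simp [edgeMatrix, h, h.not_gt]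

lemma edgeMatrix_interp (F : Finset (Edge n)) (s : ℝ) (w : Edge n → ℝ) {i j : Fin n}
    (hij : i ≠ j) :
    edgeMatrix (interp F s w) i j = max s (forestMatrix F (fun e => w e) i j) := by
  rcases lt_or_gt_of_ne hij with h | h
  · simp [edgeMatrix, h, interp]
  · rw [edgeMatrix_comm, forestMatrix_comm]
    simp [edgeMatrix, h, interp]

/-- Taking the maximum with a constant distributes over `min`, so it preserves the ultrametric
inequality. -/
lemma interp_mem_PSCoord {F : Finset (Edge n)} (hF : F ∈ forests n) {w : Edge n → ℝ}
    (hw : ∀ ℓ ∈ F, w ℓ ∈ Set.Icc (0 : ℝ) 1) {s : ℝ} (hs : s ∈ Set.Icc (0 : ℝ) 1) :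
    interp F s w ∈ PSCoord n := by
  have h01 : ∀ i j, edgeMatrix (interp F s w) i j ∈ Set.Icc (0 : ℝ) 1 := fun i j => by
    by_cases hij : i = j
    · rw [hij, edgeMatrix_self]; simp
    · rw [edgeMatrix_interp _ _ _ hij]
      exact ⟨hs.1.trans (le_max_left _ _), max_le hs.2 (forestMatrix_mem_Icc hw _ _).2⟩
  refine ⟨posSemidef_of_ultrametric _ (edgeMatrix_self _) (edgeMatrix_comm _) h01 ?_,
    edgeMatrix_self _, fun i j _ => h01 i j⟩
  intro i j k
  by_cases hik : i = k
  · rw [hik, edgeMatrix_self]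
    exact (min_le_left _ _).trans (h01 _ _).2
  by_cases hij : i = j
  · rw [hij]; exact min_le_right _ _
  by_cases hjk : j = k
  · rw [hjk]; exact min_le_left _ _
  rw [edgeMatrix_interp _ _ _ hij, edgeMatrix_interp _ _ _ hik, edgeMatrix_interp _ _ _ hjk,
    ← max_min_distrib_left]
  exact max_le_max le_rfl (forestMatrix_ultrametric hF hw i j k)

lemma edgeMatrix_interp_zero {F : Finset (Edge n)} {w : Edge n → ℝ}
    (hw : ∀ ℓ ∈ F, w ℓ ∈ Set.Icc (0 : ℝ) 1) :
    edgeMatrix (interp F 0 w) = forestMatrix F fun e => w e := by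
  ext i j
  by_cases hij : i = j
  · rw [hij, edgeMatrix_self, forestMatrix_self]
  · rw [edgeMatrix_interp _ _ _ hij, max_eq_right (forestMatrix_mem_Icc hw _ _).1]

lemma coords_forestMatrix {F : Finset (Edge n)} {w : Edge n → ℝ}
    (hw : ∀ ℓ ∈ F, w ℓ ∈ Set.Icc (0 : ℝ) 1) :
    coords (forestMatrix F fun e => w e) = interp F 0 w := by
  ext ℓ
  simp [coords, interp, (forestMatrix_mem_Icc hw _ _).1]

/-- Indexing weights by all edges puts the weights of different forests on one common cube. -/
lemma exists_extend (F : Finset (Edge n)) (w : F → ℝ) :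
    ∃ w' : Edge n → ℝ, w = fun ℓ : F => w' ℓ := by
  classical
  exact ⟨fun ℓ => if h : ℓ ∈ F then w ⟨ℓ, h⟩ else 0, by ext ℓ; simp⟩

lemma forestMatrix_mem_PS {F : Finset (Edge n)} (hF : F ∈ forests n) {w : F → ℝ}
    (hw : ∀ ℓ, w ℓ ∈ Set.Icc (0 : ℝ) 1) : forestMatrix F w ∈ PS n := by
  obtain ⟨w, rfl⟩ := exists_extend F w
  have hw' : ∀ ℓ ∈ F, w ℓ ∈ Set.Icc (0 : ℝ) 1 := fun ℓ h => hw ⟨ℓ, h⟩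
  rw [← edgeMatrix_interp_zero hw']
  exact interp_mem_PSCoord hF hw' ⟨le_rfl, zero_le_one⟩

lemma interp_congr {F : Finset (Edge n)} {s : ℝ} {w w' : Edge n → ℝ} (h : ∀ ℓ ∈ F, w ℓ = w' ℓ) :
    interp F s w = interp F s w' := by
  have : (fun e : F => w e) = fun e : F => w' e := funext fun e => h e e.2
  ext ℓ
  simp only [interp]
  rw [this]

/-- Adding an edge of weight `s` between two components of `F` does not change `interp F s w`. -/
lemma interp_insert {F : Finset (Edge n)} (hF : F ∈ forests n) {ℓ : Edge n}
    (hℓ : ℓ ∈ bridging F) (w : Edge n → ℝ) (hw : 0 ≤ w ℓ) :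
    interp (insert ℓ F) (w ℓ) w = interp F (w ℓ) w := by
  have hF' : insert ℓ F ∈ forests n := ((mem_bridging_iff hF).1 hℓ).2
  have hle : graph F ≤ graph (insert ℓ F) := graph_mono (Finset.subset_insert _ _)
  ext e
  have hij : e.1.1 ≠ e.1.2 := e.2.ne
  simp only [interp]
  generalize e.1.1 = i at *
  generalize e.1.2 = j at *
  by_cases h : (graph F).Reachable i j
  · have h' := h.mono hle
    rw [forestMatrix_of_reachable w hij h, forestMatrix_of_reachable w hij h']
    have : pathEdges (insert ℓ F) i j = pathEdges F i j := by
      obtain ⟨p, hp⟩ := h.exists_isPath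
      ext e
      rw [mem_pathEdges_iff hF hp, mem_pathEdges_iff hF' (hp.mapLe hle),
        SimpleGraph.Walk.edges_mapLe_eq_edges]
    simp only [this]
  · rw [forestMatrix_of_not_reachable _ h]
    by_cases h' : (graph (insert ℓ F)).Reachable i j
    · have hmem : ℓ ∈ pathEdges (insert ℓ F) i j := by
        obtain ⟨p, hp⟩ := h'.exists_isPath
        rw [mem_pathEdges_iff hF' hp]
        -- A path avoiding `ℓ` would already connect `i` and `j` in `F`.
        by_contra hn
        refine h ⟨p.transfer (graph F) fun e he => ?_⟩
        obtain ⟨ℓ', h1, rfl⟩ := mem_edgeSet_graph.1 (p.edges_subset_edgeSet he)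
        rcases Finset.mem_insert.1 h1 with rfl | h1
        · exact absurd he hn
        · exact toSym2_mem_edgeSet_graph.2 h1
      rw [forestMatrix_of_reachable w hij h', max_eq_left (Finset.inf'_le _ hmem)]
      exact (max_eq_left hw).symm
    · rw [forestMatrix_of_not_reachable _ h']

variable {E : Type*} [NormedAddCommGroup E] [NormedSpace ℝ E]

/-! ### The convex set `PS_n` -/

lemma edgeMatrix_combo {a b : ℝ} (hab : a + b = 1) (x y : Edge n → ℝ) :
    edgeMatrix (a • x + b • y) = a • edgeMatrix x + b • edgeMatrix y := by
  ext i j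
  simp only [edgeMatrix, Matrix.of_apply, Matrix.add_apply, Matrix.smul_apply, Pi.add_apply,
    Pi.smul_apply, smul_eq_mul]
  split_ifs
  · rfl
  · rfl
  · rw [mul_one, mul_one, hab]

lemma convex_PSCoord : Convex ℝ (PSCoord n) := by
  intro x hx y hy a b ha hb hab
  simp only [PSCoord, PS, Set.mem_ofPred_eq] at hx hy ⊢
  refine ⟨?_, edgeMatrix_self _, fun i j hij => ?_⟩
  · rw [edgeMatrix_combo hab]
    exact (hx.1.smul ha).add (hy.1.smul hb)
  · rw [edgeMatrix_combo hab]
    exact convex_Icc (0 : ℝ) 1 (hx.2.2 i j hij) (hy.2.2 i j hij) ha hb hab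

/-- Diagonal dominance: a row has fewer than `n` off-diagonal entries, each below `1 / (n + 1)`.
This open box shows that `PS_n` has interior points. -/
lemma mem_PSCoord_of_small {x : Edge n → ℝ} (hx : ∀ ℓ, x ℓ ∈ Set.Ioo (0 : ℝ) (1 / (n + 1))) :
    x ∈ PSCoord n := by
  have hδ : (1 : ℝ) / (n + 1) ≤ 1 := by
    rw [div_le_one (by positivity)]; linarith [(Nat.cast_nonneg n : (0 : ℝ) ≤ n)]
  have hoff : ∀ i j, i ≠ j → edgeMatrix x i j ∈ Set.Ioo (0 : ℝ) (1 / (n + 1)) := by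
    intro i j hij
    rcases lt_or_gt_of_ne hij with h | h
    · simpa [edgeMatrix, h] using hx ⟨(i, j), h⟩
    · rw [edgeMatrix_comm]
      simpa [edgeMatrix, h] using hx ⟨(j, i), h⟩
  refine ⟨?_, edgeMatrix_self _, fun i j hij =>
    ⟨(hoff i j hij).1.le, (hoff i j hij).2.le.trans hδ⟩⟩
  refine Matrix.PosSemidef.of_dotProduct_mulVec_nonneg ?_ fun v => ?_
  · ext i j; simp [Matrix.conjTranspose_apply, edgeMatrix_comm x i j]
  simp only [dotProduct, Matrix.mulVec, star_trivial, Finset.mul_sum]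
  set δ : ℝ := 1 / (n + 1) with hδ'
  have hδ0 : 0 < δ := by positivity
  have key : ∀ i j, (if i = j then v i ^ 2 else 0) - δ / 2 * (v i ^ 2 + v j ^ 2)
      ≤ v i * (edgeMatrix x i j * v j) := by
    intro i j
    by_cases hij : i = j
    · subst hij
      rw [edgeMatrix_self, if_pos rfl]
      nlinarith [mul_nonneg hδ0.le (sq_nonneg (v i))]
    · rw [if_neg hij]
      obtain ⟨h0, h1⟩ := hoff i j hij
      nlinarith [mul_nonneg h0.le (sq_nonneg (v i + v j)),
        mul_nonneg (sub_nonneg.2 h1.le) (add_nonneg (sq_nonneg (v i)) (sq_nonneg (v j)))]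
  refine le_trans ?_ (Finset.sum_le_sum fun i _ => Finset.sum_le_sum fun j _ => key i j)
  have : ∑ i, ∑ j, ((if i = j then v i ^ 2 else 0) - δ / 2 * (v i ^ 2 + v j ^ 2))
      = (1 - δ * n) * ∑ i, v i ^ 2 := by
    simp only [Finset.sum_sub_distrib, Finset.sum_ite_eq, Finset.mem_univ, if_true,
      ← Finset.mul_sum, Finset.sum_add_distrib, Finset.sum_const, Finset.card_univ,
      Fintype.card_fin, nsmul_eq_mul]
    ring
  rw [this]
  refine mul_nonneg ?_ (Finset.sum_nonneg fun i _ => sq_nonneg _)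
  rw [hδ', sub_nonneg, one_div, inv_mul_le_iff₀ (by positivity)]
  linarith

lemma interior_PSCoord_nonempty : (interior (PSCoord n)).Nonempty := by
  have ho : IsOpen {x : Edge n → ℝ | ∀ ℓ, x ℓ ∈ Set.Ioo (0 : ℝ) (1 / (n + 1))} := by
    have : {x : Edge n → ℝ | ∀ ℓ, x ℓ ∈ Set.Ioo (0 : ℝ) (1 / (n + 1))}
        = Set.univ.pi fun _ => Set.Ioo (0 : ℝ) (1 / (n + 1)) := by
      ext; simp
    rw [this]
    exact isOpen_set_pi Set.finite_univ fun _ _ => isOpen_Ioo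
  have h0 : (0 : ℝ) < 1 / (n + 1) := by positivity
  exact ⟨fun _ => 1 / (n + 1) / 2, interior_maximal (fun x hx => mem_PSCoord_of_small hx) ho
    fun _ => ⟨by linarith, by linarith⟩⟩

/-- This makes continuous extensions from the interior to `PS_n` unique. -/
lemma PSCoord_subset_closure_interior : PSCoord n ⊆ closure (interior (PSCoord n)) := by
  rw [convex_PSCoord.closure_interior_eq_closure_of_nonempty_interior interior_PSCoord_nonempty]
  exact subset_closure

/-! ### Iterated partial derivatives -/

section Partial

variable {U : Set (Edge n → ℝ)} {g g' : (Edge n → ℝ) → E}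

lemma partialDeriv_congr (hU : IsOpen U) (h : Set.EqOn g g' U) (ℓ : Edge n) :
    Set.EqOn (partialDeriv ℓ g) (partialDeriv ℓ g') U := fun _ hx =>
  (h.eventuallyEq_of_mem (hU.mem_nhds hx)).lineDeriv_eq

lemma partialDeriv_eq_fderiv (hU : IsOpen U) (hg : ContDiffOn ℝ ∞ g U) (ℓ : Edge n) :
    Set.EqOn (partialDeriv ℓ g) (fun x => fderiv ℝ g x (Pi.single ℓ 1)) U := fun x hx =>
  ((hg.contDiffAt (hU.mem_nhds hx)).differentiableAt (by simp)).lineDeriv_eq_fderiv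

lemma contDiffOn_partialDeriv (hU : IsOpen U) (hg : ContDiffOn ℝ ∞ g U) (ℓ : Edge n) :
    ContDiffOn ℝ ∞ (partialDeriv ℓ g) U :=
  ((hg.fderiv_of_isOpen hU (m := ∞) (by simp)).clm_apply contDiffOn_const).congr
    (partialDeriv_eq_fderiv hU hg ℓ)

lemma contDiffOn_iterPartial (hU : IsOpen U) (hg : ContDiffOn ℝ ∞ g U) (L : List (Edge n)) :
    ContDiffOn ℝ ∞ (iterPartial L g) U := by
  induction L with
  | nil => exact hg
  | cons ℓ L ih => exact contDiffOn_partialDeriv hU ih ℓ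

lemma partialDeriv_comm (hU : IsOpen U) (hg : ContDiffOn ℝ ∞ g U) (a b : Edge n) :
    Set.EqOn (partialDeriv a (partialDeriv b g)) (partialDeriv b (partialDeriv a g)) U := by
  have key : ∀ a b, Set.EqOn (partialDeriv a (partialDeriv b g))
      (fun x => fderiv ℝ (fderiv ℝ g) x (Pi.single a 1) (Pi.single b 1)) U := by
    intro a b x hx
    rw [partialDeriv_congr hU (partialDeriv_eq_fderiv hU hg b) a hx]
    have hd : DifferentiableAt ℝ (fderiv ℝ g) x :=
      ((hg.fderiv_of_isOpen hU (m := ∞) (by simp)).contDiffAt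
        (hU.mem_nhds hx)).differentiableAt (by simp)
    have hd' := hd.hasFDerivAt.clm_apply (hasFDerivAt_const (Pi.single b (1 : ℝ)) x)
    rw [partialDeriv, hd'.differentiableAt.lineDeriv_eq_fderiv, hd'.fderiv]
    simp
  intro x hx
  rw [key a b hx, key b a hx]
  exact ((hg.contDiffAt (hU.mem_nhds hx)).isSymmSndFDerivAt
    (by rw [minSmoothness_of_isRCLikeNormedField]; exact WithTop.coe_le_coe.2 (le_top : (2 : ℕ∞) ≤ ⊤))).eq _ _

/-- Needed because `Finset.toList` lists the edges in an arbitrary order. -/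
lemma iterPartial_perm (hU : IsOpen U) (hg : ContDiffOn ℝ ∞ g U) {L L' : List (Edge n)}
    (h : L.Perm L') : Set.EqOn (iterPartial L g) (iterPartial L' g) U := by
  induction h with
  | nil => exact fun _ _ => rfl
  | cons a _ ih => exact partialDeriv_congr hU ih a
  | swap a b L => exact partialDeriv_comm hU (contDiffOn_iterPartial hU hg L) b a
  | trans _ _ h1 h2 => exact h1.trans h2

end Partial

/-! ### The fundamental theorem of calculus up to the boundary of a convex set -/

/-- The segment may lie in the boundary, where `g` need not be differentiable. Contracting it by `ε`
towards an interior point puts it in the interior, where the usual theorem applies; both sides are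
continuous in `ε` down to `0`. -/
lemma sub_eq_integral_of_convex [CompleteSpace E] {K : Set (Edge n → ℝ)} (hK : Convex ℝ K)
    (hne : (interior K).Nonempty) {S : Finset (Edge n)} {g : (Edge n → ℝ) → E}
    {g' : Edge n → (Edge n → ℝ) → E} (hg : ContinuousOn g K)
    (hg' : ∀ ℓ ∈ S, ContinuousOn (g' ℓ) K) (hd : ∀ x ∈ interior K, DifferentiableAt ℝ g x)
    (hdg : ∀ ℓ ∈ S, ∀ x ∈ interior K, fderiv ℝ g x (Pi.single ℓ 1) = g' ℓ x)
    {x : Edge n → ℝ} {a : ℝ} (ha : 0 ≤ a) (hx : x ∈ K)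
    (hxa : x + a • ∑ ℓ ∈ S, Pi.single ℓ 1 ∈ K) :
    g (x + a • ∑ ℓ ∈ S, Pi.single ℓ 1) - g x
      = ∫ s in (0 : ℝ)..a, ∑ ℓ ∈ S, g' ℓ (x + s • ∑ ℓ ∈ S, Pi.single ℓ 1) := by
  set D : Edge n → ℝ := ∑ ℓ ∈ S, Pi.single ℓ 1 with hD
  obtain ⟨c, hc⟩ := hne
  have hseg : ∀ s ∈ Set.Icc 0 a, x + s • D ∈ K := by
    intro s hs
    rcases ha.eq_or_lt with rfl | ha'
    · rw [le_antisymm hs.2 hs.1]; simpa using hx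
    have := hK.add_smul_mem (y := a • D) hx hxa (t := s / a)
      ⟨div_nonneg hs.1 ha, div_le_one_of_le₀ hs.2 ha⟩
    rwa [smul_smul, div_mul_cancel₀ _ ha'.ne'] at this
  let p : ℝ → ℝ → Edge n → ℝ := fun ε s => (1 - ε) • (x + s • D) + ε • c
  have hpc : Continuous fun q : ℝ × ℝ => p q.1 q.2 := by fun_prop
  have hpK : ∀ ε ∈ Set.Icc (0 : ℝ) 1, ∀ s ∈ Set.Icc 0 a, p ε s ∈ K := fun ε hε s hs =>
    hK (hseg s hs) (interior_subset hc) (sub_nonneg.2 hε.2) hε.1 (by ring)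
  have hpU : ∀ ε ∈ Set.Ioc (0 : ℝ) 1, ∀ s ∈ Set.Icc 0 a, p ε s ∈ interior K := fun ε hε s hs =>
    hK.combo_self_interior_mem_interior (hseg s hs) hc (sub_nonneg.2 hε.2) hε.1 (by ring)
  -- Clamping the parameters makes the integrand continuous on all of `ℝ × ℝ`.
  let π₁ : ℝ → ℝ := fun ε => Set.projIcc (0 : ℝ) 1 zero_le_one ε
  let π₂ : ℝ → ℝ := fun s => Set.projIcc 0 a ha s
  have hπ₁ : Continuous π₁ := continuous_subtype_val.comp continuous_projIcc
  have hπ₂ : Continuous π₂ := continuous_subtype_val.comp continuous_projIcc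
  have hπ₁' : ∀ ε ∈ Set.Icc (0 : ℝ) 1, π₁ ε = ε := fun ε hε => by
    simp [π₁, Set.projIcc_of_mem zero_le_one hε]
  have hπ₂' : ∀ s ∈ Set.Icc 0 a, π₂ s = s := fun s hs => by
    simp [π₂, Set.projIcc_of_mem ha hs]
  -- The factor `1 - ε` is the speed of the contracted segment.
  let H : ℝ → ℝ → E := fun ε s => (1 - ε) • ∑ ℓ ∈ S, g' ℓ (p (π₁ ε) (π₂ s))
  have hH : Continuous (Function.uncurry H) := by
    have : Continuous fun q : ℝ × ℝ => p (π₁ q.1) (π₂ q.2) :=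
      hpc.comp ((hπ₁.comp continuous_fst).prodMk (hπ₂.comp continuous_snd))
    refine (continuous_const.sub continuous_fst).smul (continuous_finsetSum _ fun ℓ hℓ => ?_)
    exact (hg' ℓ hℓ).comp_continuous this fun q =>
      hpK _ (Subtype.prop _) _ (Subtype.prop _)
  have hL : ∀ s ∈ Set.Icc 0 a, Continuous fun ε => g (p (π₁ ε) s) := fun s hs =>
    hg.comp_continuous (hpc.comp (hπ₁.prodMk continuous_const)) fun q => hpK _ (Subtype.prop _) _ hs
  have h0 : (0 : ℝ) ∈ Set.Icc 0 a := ⟨le_rfl, ha⟩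
  have haa : a ∈ Set.Icc 0 a := ⟨ha, le_rfl⟩
  have heq : Set.EqOn (fun ε => g (p (π₁ ε) a) - g (p (π₁ ε) 0)) (fun ε => ∫ s in (0 : ℝ)..a, H ε s)
      (Set.Ioc 0 1) := by
    intro ε hε
    have hε' : ε ∈ Set.Icc (0 : ℝ) 1 := ⟨hε.1.le, hε.2⟩
    simp only [hπ₁' ε hε']
    symm
    refine intervalIntegral.integral_eq_sub_of_hasDerivAt (f := fun s => g (p ε s))
      (fun s hs => ?_) ?_
    · rw [Set.uIcc_of_le ha] at hs
      have h1 : HasDerivAt (fun s => p ε s) ((1 - ε) • D) s := by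
        have := ((((hasDerivAt_id s).smul_const D).const_add x).const_smul (1 - ε)).add_const
          (ε • c)
        rwa [one_smul] at this
      refine HasDerivAt.congr_deriv (f := fun s => g (p ε s))
        ((hd _ (hpU ε hε s hs)).hasFDerivAt.comp_hasDerivAt s h1) ?_
      change _ = (1 - ε) • ∑ ℓ ∈ S, g' ℓ (p (π₁ ε) (π₂ s))
      rw [hπ₁' ε hε', hπ₂' s hs, map_smul, hD, map_sum]
      congr 1
      exact Finset.sum_congr rfl fun ℓ hℓ => hdg ℓ hℓ _ (hpU ε hε s hs)
    · exact Continuous.intervalIntegrable (hH.comp (continuous_const.prodMk continuous_id)) _ _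
  have := heq.closure ((hL a haa).sub (hL 0 h0))
    (intervalIntegral.continuous_parametric_intervalIntegral_of_continuous' hH 0 a)
  rw [closure_Ioc zero_ne_one] at this
  have h1 := this (⟨le_rfl, zero_le_one⟩ : (0 : ℝ) ∈ Set.Icc (0 : ℝ) 1)
  have hz : π₁ 0 = 0 := hπ₁' 0 ⟨le_rfl, zero_le_one⟩
  simp only [hz, p, H] at h1
  simp only [sub_zero, one_smul, zero_smul, add_zero] at h1
  rw [h1]
  refine intervalIntegral.integral_congr fun s hs => ?_
  rw [Set.uIcc_of_le ha] at hs
  simp only [hπ₂' s hs]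

/-! ### The extended derivatives -/

/-- The extension to `PS_n` of `∂_F f`, as a function of the coordinates. -/
def extDeriv (f : Matrix (Fin n) (Fin n) ℝ → E) (F : Finset (Edge n)) : (Edge n → ℝ) → E :=
  extendFrom (interior (PSCoord n)) (iterPartial F.toList fun x => f (edgeMatrix x))

variable {f : Matrix (Fin n) (Fin n) ℝ → E}

/-- Limits from the interior are unique, so `extendFrom` agrees on `PS_n` with whichever extension
the hypothesis supplies. -/
lemma SmoothOnPS.extendFrom_spec (hf : SmoothOnPS f) (L : List (Edge n)) :
    ContinuousOn (extendFrom (interior (PSCoord n)) (iterPartial L fun x => f (edgeMatrix x)))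
      (PSCoord n) ∧
    Set.EqOn (extendFrom (interior (PSCoord n)) (iterPartial L fun x => f (edgeMatrix x)))
      (iterPartial L fun x => f (edgeMatrix x)) (interior (PSCoord n)) := by
  obtain ⟨g, hg, hgL⟩ := hf.exists_extension L
  have h : Set.EqOn (extendFrom (interior (PSCoord n)) (iterPartial L fun x => f (edgeMatrix x)))
      g (PSCoord n) := fun x hx =>
    extendFrom_eq (PSCoord_subset_closure_interior hx)
      (((hg x hx).mono interior_subset).tendsto.congr' hgL.eventuallyEq_nhdsWithin)
  exact ⟨hg.congr h, (h.mono interior_subset).trans hgL⟩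

lemma SmoothOnPS.continuousOn_extDeriv (hf : SmoothOnPS f) (F : Finset (Edge n)) :
    ContinuousOn (extDeriv f F) (PSCoord n) :=
  (hf.extendFrom_spec _).1

lemma SmoothOnPS.extDeriv_empty (hf : SmoothOnPS f) {x : Edge n → ℝ} (hx : x ∈ PSCoord n) :
    extDeriv f ∅ x = f (edgeMatrix x) := by
  rw [extDeriv, Finset.toList_empty]
  exact extendFrom_eq (PSCoord_subset_closure_interior hx)
    ((hf.continuousOn x hx).mono interior_subset).tendsto

lemma SmoothOnPS.extDeriv_insert (hf : SmoothOnPS f) {F : Finset (Edge n)}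
    {ℓ : Edge n} (hℓ : ℓ ∉ F) {x : Edge n → ℝ} (hx : x ∈ interior (PSCoord n)) :
    extDeriv f (insert ℓ F) x = fderiv ℝ (extDeriv f F) x (Pi.single ℓ 1) := by
  have hF := (hf.extendFrom_spec F.toList).2
  rw [extDeriv, (hf.extendFrom_spec _).2 hx, iterPartial_perm isOpen_interior
    hf.contDiffOn_interior (Finset.toList_insert hℓ) hx]
  change partialDeriv ℓ (iterPartial F.toList _) x = _
  rw [extDeriv, (hF.eventuallyEq_of_mem (isOpen_interior.mem_nhds hx)).fderiv_eq]
  exact partialDeriv_eq_fderiv isOpen_interior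
    (contDiffOn_iterPartial isOpen_interior hf.contDiffOn_interior _) ℓ hx

lemma SmoothOnPS.differentiableAt_extDeriv (hf : SmoothOnPS f) (F : Finset (Edge n))
    {x : Edge n → ℝ} (hx : x ∈ interior (PSCoord n)) : DifferentiableAt ℝ (extDeriv f F) x :=
  ((((contDiffOn_iterPartial isOpen_interior hf.contDiffOn_interior F.toList).contDiffAt
    (isOpen_interior.mem_nhds hx)).differentiableAt (by simp))).congr_of_eventuallyEq
    ((hf.extendFrom_spec F.toList).2.eventuallyEq_of_mem (isOpen_interior.mem_nhds hx))

/-- Entries inside a component are at least the least weight, hence at least `s`, and do not move.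
So `s ↦ interp F s w` is a straight segment, as the fundamental theorem requires. -/
lemma interp_eq_add {F : Finset (Edge n)} {w : Edge n → ℝ}
    (hw : ∀ ℓ ∈ F, w ℓ ∈ Set.Icc (0 : ℝ) 1) {s : ℝ} (hs : 0 ≤ s) (hsw : ∀ ℓ ∈ F, s ≤ w ℓ) :
    interp F s w = interp F 0 w + s • ∑ ℓ ∈ bridging F, Pi.single ℓ 1 := by
  classical
  ext e
  have hb : (∑ ℓ ∈ bridging F, Pi.single ℓ (1 : ℝ) : Edge n → ℝ) e
      = if (graph F).Reachable e.1.1 e.1.2 then 0 else 1 := by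
    simp [Finset.sum_apply, Pi.single_apply, bridging]
  simp only [Pi.add_apply, Pi.smul_apply, hb, interp, smul_eq_mul]
  by_cases h : (graph F).Reachable e.1.1 e.1.2
  · have h1 := forestMatrix_of_reachable w e.2.ne h
    have h2 : s ≤ forestMatrix F (fun ℓ => w ℓ) e.1.1 e.1.2 := by
      rw [h1]; exact Finset.le_inf' _ _ fun ℓ hℓ => hsw ℓ (mem_pathEdges.1 hℓ).1
    rw [max_eq_right h2, max_eq_right (forestMatrix_mem_Icc hw _ _).1, if_pos h]
    simp
  · rw [forestMatrix_of_not_reachable _ h, if_neg h]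
    simp [hs]

/-- The interpolation formula: the variation of `∂_F f` as all pairs of points in different
components of the forest `F` are coupled with a common strength growing from `0` to `a`. -/
lemma SmoothOnPS.extDeriv_interp_sub [CompleteSpace E] (hf : SmoothOnPS f)
    {F : Finset (Edge n)} (hF : F ∈ forests n) {w : Edge n → ℝ}
    (hw : ∀ ℓ ∈ F, w ℓ ∈ Set.Icc (0 : ℝ) 1) {a : ℝ} (ha : a ∈ Set.Icc (0 : ℝ) 1)
    (haw : ∀ ℓ ∈ F, a ≤ w ℓ) :
    extDeriv f F (interp F a w) - extDeriv f F (interp F 0 w)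
      = ∫ s in (0 : ℝ)..a, ∑ ℓ ∈ bridging F, extDeriv f (insert ℓ F) (interp F s w) := by
  have h0 := interp_mem_PSCoord hF hw (s := 0) ⟨le_rfl, zero_le_one⟩
  have h1 := interp_mem_PSCoord hF hw ha
  rw [interp_eq_add hw ha.1 haw] at h1 ⊢
  rw [sub_eq_integral_of_convex convex_PSCoord interior_PSCoord_nonempty
    (hf.continuousOn_extDeriv F) (g' := fun ℓ => extDeriv f (insert ℓ F))
    (fun ℓ _ => hf.continuousOn_extDeriv _) (fun x hx => hf.differentiableAt_extDeriv F hx)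
    (fun ℓ hℓ x hx => (hf.extDeriv_insert ((mem_bridging_iff hF).1 hℓ).1 hx).symm) ha.1 h0 h1]
  refine intervalIntegral.integral_congr fun s hs => ?_
  rw [Set.uIcc_of_le ha.1] at hs
  simp only [interp_eq_add hw hs.1 fun ℓ hℓ => hs.2.trans (haw ℓ hℓ)]

/-! ### Independent variables, uniformly distributed on `[0, 1]` -/

section Measure

variable {ι : Type*} [Fintype ι]

/-- The uniform measure on `[0, 1]`. -/
abbrev unif : Measure ℝ := volume.restrict (Set.Icc (0 : ℝ) 1)

instance : IsProbabilityMeasure unif := ⟨by simp⟩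

lemma volume_restrict_cube :
    (volume : Measure (ι → ℝ)).restrict (Set.Icc 0 1) = Measure.pi fun _ => unif := by
  rw [← Set.pi_univ_Icc, volume_pi, Measure.restrict_pi_pi]
  rfl

instance : IsProbabilityMeasure ((volume : Measure (ι → ℝ)).restrict (Set.Icc 0 1)) := by
  rw [volume_restrict_cube]; infer_instance

/-- Resampling one coordinate independently: this turns the parameter `s` of the interpolation into
the weight of the added edge. -/
lemma measurePreserving_update [DecidableEq ι] (i : ι) :
    MeasurePreserving (fun q : (ι → ℝ) × ℝ => Function.update q.1 i q.2)
      (((volume : Measure (ι → ℝ)).restrict (Set.Icc 0 1)).prod unif)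
      ((volume : Measure (ι → ℝ)).restrict (Set.Icc 0 1)) := by
  have hm : Measurable fun q : (ι → ℝ) × ℝ => Function.update q.1 i q.2 := by
    refine measurable_pi_iff.2 fun j => ?_
    by_cases h : j = i
    · subst h; simpa using measurable_snd
    · simpa [h, Function.comp_def] using (measurable_pi_apply j).comp measurable_fst
  refine ⟨hm, ?_⟩
  rw [volume_restrict_cube]
  refine (Measure.pi_eq fun s hs => ?_).symm
  rw [Measure.map_apply hm (MeasurableSet.univ_pi hs)]
  have : (fun q : (ι → ℝ) × ℝ => Function.update q.1 i q.2) ⁻¹' Set.univ.pi s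
      = (Set.univ.pi (Function.update s i Set.univ)) ×ˢ s i := by
    ext ⟨w, t⟩
    simp only [Set.mem_preimage, Set.mem_univ_pi, Set.mem_prod]
    constructor
    · intro h
      refine ⟨fun j => ?_, by simpa using h i⟩
      by_cases hj : j = i
      · subst hj; simp
      · simpa [hj] using h j
    · rintro ⟨h, h'⟩ j
      by_cases hj : j = i
      · subst hj; simpa using h'
      · simpa [hj] using h j
  rw [this, Measure.prod_prod, Measure.pi_pi, ← Finset.prod_erase_mul _ _ (Finset.mem_univ i),
    ← Finset.prod_erase_mul _ _ (Finset.mem_univ i)]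
  simp only [Function.update_self, measure_univ, mul_one]
  congr 1
  refine Finset.prod_congr rfl fun j hj => ?_
  rw [Function.update_of_ne (Finset.ne_of_mem_erase hj)]

lemma measurePreserving_restrict_cube (F : Finset ι) :
    MeasurePreserving (fun (w : ι → ℝ) (e : F) => w e)
      ((volume : Measure (ι → ℝ)).restrict (Set.Icc 0 1))
      ((volume : Measure (F → ℝ)).restrict (Set.Icc 0 1)) := by
  classical
  rw [volume_restrict_cube, volume_restrict_cube]
  have h := measurePreserving_fst.comp
    (measurePreserving_piEquivPiSubtypeProd (fun _ : ι => unif) fun i => i ∈ F)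
  rw [Subsingleton.elim (Subtype.fintype fun i => i ∈ F) (Finset.Subtype.fintype F)] at h
  exact h

/-- Ties lie in finitely many hyperplanes `w i = w j`, which are null. -/
lemma ae_injective_cube :
    ∀ᵐ w ∂(volume : Measure (ι → ℝ)).restrict (Set.Icc 0 1), Function.Injective w := by
  classical
  refine ae_restrict_of_ae ?_
  have : ∀ i j : ι, ∀ᵐ w : ι → ℝ, i ≠ j → w i ≠ w j := by
    intro i j
    by_cases hij : i = j
    · simp [hij]
    let V : Submodule ℝ (ι → ℝ) := LinearMap.ker
      (LinearMap.proj (φ := fun _ : ι => ℝ) i - LinearMap.proj (R := ℝ) (φ := fun _ : ι => ℝ) j)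
    have hV : V ≠ ⊤ := by
      intro h
      have : (Pi.single i 1 : ι → ℝ) ∈ V := h ▸ Submodule.mem_top
      simp [V, hij] at this
    have h0 := Measure.addHaar_submodule volume V hV
    filter_upwards [measure_eq_zero_iff_ae_notMem.1 h0] with w hw _ h
    exact hw (by simp [V, h])
  filter_upwards [ae_all_iff.2 fun i => ae_all_iff.2 (this i)] with w hw i j h
  by_contra hij
  exact hw i j hij h

end Measure

/-! ### The telescoping sum over forests -/

/-- The minimum of `1` and the weights of the edges in `F`. -/
def minWeight (F : Finset (Edge n)) (w : Edge n → ℝ) : ℝ := F.fold min 1 w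

lemma le_minWeight {F : Finset (Edge n)} {w : Edge n → ℝ} {s : ℝ} :
    s ≤ minWeight F w ↔ s ≤ 1 ∧ ∀ ℓ ∈ F, s ≤ w ℓ :=
  Finset.le_fold_min s

lemma continuous_minWeight (F : Finset (Edge n)) : Continuous (minWeight F) := by
  induction F using Finset.induction_on with
  | empty => exact continuous_const
  | insert ℓ F h ih =>
    have : minWeight (insert ℓ F) = fun w => min (w ℓ) (minWeight F w) :=
      funext fun w => Finset.fold_insert h
    rw [this]
    exact (continuous_apply ℓ).min ih

lemma minWeight_mem_Icc {F : Finset (Edge n)} {w : Edge n → ℝ}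
    (hw : w ∈ Set.Icc (0 : Edge n → ℝ) 1) : minWeight F w ∈ Set.Icc (0 : ℝ) 1 :=
  ⟨le_minWeight.2 ⟨zero_le_one, fun ℓ _ => hw.1 ℓ⟩, (le_minWeight.1 le_rfl).1⟩

lemma minWeight_update {F : Finset (Edge n)} {ℓ : Edge n} (h : ℓ ∉ F) (w : Edge n → ℝ) (s : ℝ) :
    minWeight F (Function.update w ℓ s) = minWeight F w :=
  Finset.fold_congr fun _ he => Function.update_of_ne (ne_of_mem_of_not_mem he h) _ _

lemma SmoothOnPS.continuousOn_extDeriv_interp_comp (hf : SmoothOnPS f) {F : Finset (Edge n)}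
    (hF : F ∈ forests n) {a : (Edge n → ℝ) → ℝ} (ha : Continuous a)
    (ha' : ∀ w ∈ Set.Icc (0 : Edge n → ℝ) 1, a w ∈ Set.Icc (0 : ℝ) 1) :
    ContinuousOn (fun w => extDeriv f F (interp F (a w) w)) (Set.Icc 0 1) :=
  (hf.continuousOn_extDeriv F).comp
    ((continuous_interp F).comp (ha.prodMk continuous_id)).continuousOn fun w hw =>
      interp_mem_PSCoord hF (fun ℓ _ => ⟨hw.1 ℓ, hw.2 ℓ⟩) (ha' w hw)

lemma SmoothOnPS.continuousOn_forestDeriv (hf : SmoothOnPS f) {F : Finset (Edge n)}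
    (hF : F ∈ forests n) :
    ContinuousOn (fun w : F → ℝ => forestDeriv F f (forestMatrix F w)) (Set.Icc 0 1) := by
  let e : (F → ℝ) → Edge n → ℝ := fun w ℓ => if h : ℓ ∈ F then w ⟨ℓ, h⟩ else 0
  have he : Continuous e := continuous_pi fun ℓ => by
    by_cases h : ℓ ∈ F
    · simpa [e, h] using continuous_apply (⟨ℓ, h⟩ : F)
    · simpa [e, h] using continuous_const
  have he' : ∀ w ∈ Set.Icc (0 : F → ℝ) 1, e w ∈ Set.Icc (0 : Edge n → ℝ) 1 := by
    intro w hw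
    constructor <;> intro ℓ <;> by_cases h : ℓ ∈ F <;> simp only [e, h, dif_pos] <;>
      simp
    · exact hw.1 _
    · exact hw.2 _
  have hew : ∀ w, (fun ℓ : F => e w ℓ) = w := fun w => by ext ℓ; simp [e]
  refine ((hf.continuousOn_extDeriv_interp_comp hF continuous_const
    fun _ _ => ⟨le_rfl, zero_le_one⟩).comp he.continuousOn he').congr fun w hw => ?_
  have := coords_forestMatrix (F := F) (w := e w) fun ℓ _ => ⟨(he' w hw).1 ℓ, (he' w hw).2 ℓ⟩
  rw [hew] at this
  simp only [forestDeriv, this]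
  rfl

/-- The integrand sees only the weights of `F`; the remaining variables are integrated against
probability measures. -/
lemma SmoothOnPS.integral_forestDeriv (hf : SmoothOnPS f) {F : Finset (Edge n)}
    (hF : F ∈ forests n) :
    ∫ w : F → ℝ in Set.Icc 0 1, forestDeriv F f (forestMatrix F w)
      = ∫ w : Edge n → ℝ in Set.Icc 0 1, extDeriv f F (interp F 0 w) := by
  have hp := measurePreserving_restrict_cube F
  rw [← hp.map_eq, integral_map hp.measurable.aemeasurable]
  · refine setIntegral_congr_fun measurableSet_Icc fun w hw => ?_
    simp only [forestDeriv]
    rw [coords_forestMatrix fun ℓ _ => ⟨hw.1 ℓ, hw.2 ℓ⟩]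
    rfl
  · rw [hp.map_eq]
    exact ((hf.continuousOn_forestDeriv hF).integrableOn_compact
      isCompact_Icc).aestronglyMeasurable

open Classical in
/-- The contribution to `∂_{F ∪ ℓ} f` of the event that `ℓ` is the edge of least weight. -/
def leastEdgeTerm (f : Matrix (Fin n) (Fin n) ℝ → E) (F : Finset (Edge n)) (ℓ : Edge n)
    (w : Edge n → ℝ) : E :=
  if w ℓ ≤ minWeight F w then extDeriv f (insert ℓ F) (interp (insert ℓ F) (w ℓ) w) else 0

lemma SmoothOnPS.integrable_leastEdgeTerm (hf : SmoothOnPS f) {F : Finset (Edge n)} {ℓ : Edge n}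
    (hF : insert ℓ F ∈ forests n) :
    Integrable (leastEdgeTerm f F ℓ) (volume.restrict (Set.Icc 0 1)) := by
  have h : leastEdgeTerm f F ℓ = {w | w ℓ ≤ minWeight F w}.indicator
      fun w => extDeriv f (insert ℓ F) (interp (insert ℓ F) (w ℓ) w) := by
    ext w; simp [leastEdgeTerm, Set.indicator]
  rw [h]
  exact ((hf.continuousOn_extDeriv_interp_comp hF (continuous_apply ℓ)
    fun w hw => ⟨hw.1 ℓ, hw.2 ℓ⟩).integrableOn_compact isCompact_Icc).integrable.indicator
    (isClosed_le (continuous_apply ℓ) (continuous_minWeight F)).measurableSet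

/-- Neither the least weight of `F` nor `interp F s` depends on the weight of `ℓ`, and
`interp_insert` removes `ℓ` from the forest inside `interp`. -/
lemma leastEdgeTerm_update {F : Finset (Edge n)} (hF : F ∈ forests n) {ℓ : Edge n}
    (hℓ : ℓ ∈ bridging F) (w : Edge n → ℝ) {s : ℝ} (hs : 0 ≤ s) :
    leastEdgeTerm f F ℓ (Function.update w ℓ s)
      = (Set.Iic (minWeight F w)).indicator
        (fun s => extDeriv f (insert ℓ F) (interp F s w)) s := by
  have hℓF := ((mem_bridging_iff hF).1 hℓ).1
  have h1 := interp_insert hF hℓ (Function.update w ℓ s) (by simpa using hs)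
  rw [interp_congr (F := F) (w' := w) fun e he =>
    Function.update_of_ne (ne_of_mem_of_not_mem he hℓF) _ _] at h1
  rw [leastEdgeTerm, minWeight_update hℓF, h1]
  simp [Set.indicator]

lemma SmoothOnPS.extDeriv_interp_zero [CompleteSpace E] (hf : SmoothOnPS f) {F : Finset (Edge n)}
    (hF : F ∈ forests n) {w : Edge n → ℝ} (hw : w ∈ Set.Icc (0 : Edge n → ℝ) 1) :
    extDeriv f F (interp F 0 w) = extDeriv f F (interp F (minWeight F w) w)
      - ∑ ℓ ∈ bridging F, ∫ s, leastEdgeTerm f F ℓ (Function.update w ℓ s) ∂unif := by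
  have hw' : ∀ ℓ ∈ F, w ℓ ∈ Set.Icc (0 : ℝ) 1 := fun ℓ _ => ⟨hw.1 ℓ, hw.2 ℓ⟩
  have ha := minWeight_mem_Icc (F := F) hw
  rw [eq_sub_iff_add_eq, ← eq_sub_iff_add_eq',
    hf.extDeriv_interp_sub hF hw' ha (le_minWeight.1 le_rfl).2]
  have hint : ∀ ℓ ∈ bridging F, IntegrableOn
      (fun s => extDeriv f (insert ℓ F) (interp F s w)) (Set.Icc 0 1) := fun ℓ hℓ =>
    ContinuousOn.integrableOn_compact isCompact_Icc ((hf.continuousOn_extDeriv _).comp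
      ((continuous_interp F).comp (continuous_id.prodMk continuous_const)).continuousOn
      fun s hs => interp_mem_PSCoord hF hw' hs)
  rw [intervalIntegral.integral_of_le ha.1, integral_finsetSum]
  swap
  · exact fun ℓ hℓ => (hint ℓ hℓ).mono_set
      (Set.Ioc_subset_Icc_self.trans (Set.Icc_subset_Icc_right ha.2))
  refine Finset.sum_congr rfl fun ℓ hℓ => ?_
  -- The indicator of `s ≤ minWeight F w` cuts `[0, 1]` down to the range of the interpolation.
  rw [setIntegral_congr_fun measurableSet_Icc
    fun s hs => leastEdgeTerm_update (f := f) hF hℓ w hs.1,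
    setIntegral_indicator measurableSet_Iic, ← integral_Icc_eq_integral_Ioc]
  congr 2
  ext s
  simp only [Set.mem_inter_iff, Set.mem_Icc, Set.mem_Iic]
  exact ⟨fun h => ⟨h.1.1, h.2⟩, fun h => ⟨⟨h.1, h.2.trans ha.2⟩, h.2⟩⟩

lemma SmoothOnPS.integral_extDeriv_interp_zero [CompleteSpace E] (hf : SmoothOnPS f)
    {F : Finset (Edge n)} (hF : F ∈ forests n) :
    ∫ w in Set.Icc 0 1, extDeriv f F (interp F 0 w)
      = (∫ w in Set.Icc 0 1, extDeriv f F (interp F (minWeight F w) w))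
        - ∑ ℓ ∈ bridging F, ∫ w in Set.Icc 0 1, leastEdgeTerm f F ℓ w := by
  have hi : ∀ ℓ ∈ bridging F, Integrable
      (fun q : (Edge n → ℝ) × ℝ => leastEdgeTerm f F ℓ (Function.update q.1 ℓ q.2))
      ((volume.restrict (Set.Icc 0 1)).prod unif) := fun ℓ hℓ =>
    (measurePreserving_update ℓ).integrable_comp_of_integrable
      (hf.integrable_leastEdgeTerm ((mem_bridging_iff hF).1 hℓ).2)
  rw [setIntegral_congr_fun measurableSet_Icc fun w hw => hf.extDeriv_interp_zero hF hw,
    integral_sub, integral_finsetSum]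
  · congr 1
    refine Finset.sum_congr rfl fun ℓ hℓ => ?_
    have hp := measurePreserving_update ℓ
    rw [← integral_prod _ (hi ℓ hℓ)]
    conv_rhs => rw [← hp.map_eq]
    rw [integral_map hp.measurable.aemeasurable]
    rw [hp.map_eq]
    exact (hf.integrable_leastEdgeTerm ((mem_bridging_iff hF).1 hℓ).2).aestronglyMeasurable
  · exact fun ℓ hℓ => (hi ℓ hℓ).integral_prod_left
  · exact ((hf.continuousOn_extDeriv_interp_comp hF (continuous_minWeight F)
      fun w hw => minWeight_mem_Icc hw).integrableOn_compact isCompact_Icc)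
  · exact integrable_finsetSum _ fun ℓ hℓ => (hi ℓ hℓ).integral_prod_left

/-- Almost every `w` has a single least edge in `F`, and only its term is nonzero. -/
lemma SmoothOnPS.integral_extDeriv_minWeight (hf : SmoothOnPS f)
    {F : Finset (Edge n)} (hF : F ∈ forests n) (hne : F.Nonempty) :
    ∫ w in Set.Icc 0 1, extDeriv f F (interp F (minWeight F w) w)
      = ∑ ℓ ∈ F, ∫ w in Set.Icc 0 1, leastEdgeTerm f (F.erase ℓ) ℓ w := by
  rw [← integral_finsetSum]
  swap
  · exact fun ℓ hℓ => hf.integrable_leastEdgeTerm (by rwa [Finset.insert_erase hℓ])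
  refine integral_congr_ae ?_
  filter_upwards [ae_restrict_mem measurableSet_Icc, ae_injective_cube] with w hw hinj
  obtain ⟨ℓ, hℓ, hmin⟩ := F.exists_min_image w hne
  rw [Finset.sum_eq_single_of_mem ℓ hℓ]
  · have h1 : minWeight F w = w ℓ := le_antisymm ((le_minWeight.1 le_rfl).2 ℓ hℓ)
      (le_minWeight.2 ⟨hw.2 ℓ, hmin⟩)
    rw [leastEdgeTerm, if_pos, Finset.insert_erase hℓ, h1]
    exact le_minWeight.2 ⟨hw.2 ℓ, fun e he => hmin e (Finset.mem_of_mem_erase he)⟩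
  · intro e he hne
    rw [leastEdgeTerm, if_neg]
    intro h
    have := (le_minWeight.1 h).2 ℓ (Finset.mem_erase.2 ⟨hne.symm, hℓ⟩)
    exact hne (hinj (le_antisymm this (hmin e he)))

/-- Both sides sum over forests with a marked edge, described either before or after the edge is
added. -/
lemma sum_bridging_eq_sum_erase {M : Type*} [AddCommMonoid M]
    (Φ : Finset (Edge n) → Edge n → M) :
    ∑ F ∈ forests n, ∑ ℓ ∈ bridging F, Φ F ℓ = ∑ F ∈ forests n, ∑ ℓ ∈ F, Φ (F.erase ℓ) ℓ := by
  rw [Finset.sum_sigma', Finset.sum_sigma']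
  refine Finset.sum_bij' (fun q _ => ⟨insert q.2 q.1, q.2⟩) (fun q _ => ⟨q.1.erase q.2, q.2⟩)
    ?_ ?_ ?_ ?_ ?_
  · rintro ⟨F, ℓ⟩ h
    rw [Finset.mem_sigma] at h
    exact Finset.mem_sigma.2
      ⟨((mem_bridging_iff h.1).1 h.2).2, Finset.mem_insert_self _ _⟩
  · rintro ⟨F, ℓ⟩ h
    obtain ⟨hF, hℓ⟩ := Finset.mem_sigma.1 h
    have hF' := mem_forests_of_subset (Finset.erase_subset ℓ F) hF
    refine Finset.mem_sigma.2 ⟨hF', (mem_bridging_iff hF').2 ⟨Finset.notMem_erase _ _, ?_⟩⟩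
    rwa [Finset.insert_erase hℓ]
  · rintro ⟨F, ℓ⟩ h
    rw [Finset.mem_sigma] at h
    simp [Finset.erase_insert ((mem_bridging_iff h.1).1 h.2).1]
  · rintro ⟨F, ℓ⟩ h
    rw [Finset.mem_sigma] at h
    simp [Finset.insert_erase h.2]
  · rintro ⟨F, ℓ⟩ h
    rw [Finset.mem_sigma] at h
    simp [Finset.erase_insert ((mem_bridging_iff h.1).1 h.2).1]

lemma empty_mem_forests : (∅ : Finset (Edge n)) ∈ forests n := by
  rw [mem_forests, graph_empty]
  exact SimpleGraph.isAcyclic_bot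

lemma edgeMatrix_interp_one {w : Edge n → ℝ} :
    edgeMatrix (interp ∅ 1 w) = Matrix.of fun _ _ => 1 := by
  ext i j
  by_cases hij : i = j
  · rw [hij, edgeMatrix_self]; rfl
  · rw [edgeMatrix_interp _ _ _ hij, max_eq_left (forestMatrix_mem_Icc (by simp) _ _).2]; rfl

lemma SmoothOnPS.forest_formula [CompleteSpace E] (hf : SmoothOnPS f) :
    f (Matrix.of fun _ _ => 1) =
      ∑ F ∈ forests n, ∫ w : F → ℝ in Set.Icc 0 1, forestDeriv F f (forestMatrix F w) := by
  -- After reindexing, the summand of each nonempty forest is its leading term minus that same term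
  -- split by least edge, hence zero.
  rw [Finset.sum_congr rfl fun F hF =>
    (hf.integral_forestDeriv hF).trans (hf.integral_extDeriv_interp_zero hF),
    Finset.sum_sub_distrib, sum_bridging_eq_sum_erase, ← Finset.sum_sub_distrib,
    Finset.sum_eq_single_of_mem ∅ empty_mem_forests]
  · have h : ∀ w : Edge n → ℝ,
        extDeriv f ∅ (interp ∅ (minWeight ∅ w) w) = f (Matrix.of fun _ _ => 1) := by
      intro w
      rw [minWeight, Finset.fold_empty, hf.extDeriv_empty, edgeMatrix_interp_one]
      exact interp_mem_PSCoord empty_mem_forests (by simp) ⟨zero_le_one, le_rfl⟩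
    simp only [h, Finset.sum_empty, sub_zero, integral_const, probReal_univ, one_smul]
  · intro F hF hne
    rw [hf.integral_extDeriv_minWeight hF (Finset.nonempty_iff_ne_empty.2 hne), sub_self]

end ForestFormula

end

open ForestFormula
theorem theorem2p2 (n : ℕ) {E : Type*} [NormedAddCommGroup E] [NormedSpace ℝ E] [CompleteSpace E]
    (f : Matrix (Fin n) (Fin n) ℝ → E) (hf : SmoothOnPS f) :
    (∀ F ∈ forests n, ∀ w : F → ℝ, (∀ ℓ, w ℓ ∈ Set.Icc (0 : ℝ) 1) → forestMatrix F w ∈ PS n) ∧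
    (∀ F ∈ forests n, IntegrableOn (fun w : F → ℝ => forestDeriv F f (forestMatrix F w))
      (Set.Icc 0 1)) ∧
    f (Matrix.of fun _ _ => 1) =
      ∑ F ∈ forests n, ∫ w : F → ℝ in Set.Icc 0 1, forestDeriv F f (forestMatrix F w) :=
  ⟨fun _ hF _ hw => forestMatrix_mem_PS hF hw,
    fun _ hF => (hf.continuousOn_forestDeriv hF).integrableOn_compact isCompact_Icc,
    hf.forest_formula⟩
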